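/- Let $B$ be a non-empty binary tree, in which each vertex has at most one left child and at most one right child. Write $LV(B)$ and $RV(B)$ for the sets of left children and of right children of $B$ (the root belongs to neither). A \emph{non-ambiguous tree} (NAT) of shape $B$ is a labelling $T$ of the non-root vertices of $B$ such that the left (resp. right) children carry the labels $1,\dots,|LV(B)|$ (resp. $1,\dots,|RV(B)|$), each exactly once, and such that, whenever $U$ and $V$ are both left children or both right children and $U$ is a proper ancestor of $V$, the label of $U$ is strictly greater than that of $V$. Let $\mathrm{NAT}(B)$ be the set of NATs of shape $B$. Let $\sigma_L(T)\in\mathfrak S_{|LV(B)|}$ be the permutation whose one-line notation is obtained by reading the labels of the left children in left postfix order: recursively the left subtree, then the right subtree, then the root (if it is a left child). Let $\sigma_R(T)\in\mathfrak S_{|RV(B)|}$ be obtained by reading the labels of the right children in right postfix order: recursively the right subtree, then the left subtree, then the root (if it is a right child). For $\sigma\in\mathfrak S_n$ let $\mathrm{inv}(\sigma)$ be the number of pairs $i<j$ with $\sigma(i)>\sigma(j)$, and let $\mathrm{imaj}(\sigma)$ be the sum of all $i\in\{1,\dots,n-1\}$ with $\sigma^{-1}(i)>\sigma^{-1}(i+1)$.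 Let $q_L,q_R$ be two indeterminates, and put $[n]_q=\frac{1-q^n}{1-q}$ and $[n]_q!=\prod_{i=1}^n[i]_q$. For a left (resp. right) child $U$ let $E_L(U)$ (resp. $E_R(U)$) be the number of left (resp. right) children of $B$ lying in the subtree of $B$ with root $U$, with $U$ itself included. Then for each $S\in\{\mathrm{inv},\mathrm{imaj}\}$, in $\mathbb Q(q_L,q_R)$, $$\sum_{T\in\mathrm{NAT}(B)} q_L^{S(\sigma_L(T))}\,q_R^{S(\sigma_R(T))}=\frac{[\,|LV(B)|\,]_{q_L}!\;[\,|RV(B)|\,]_{q_R}!}{\displaystyle\prod_{U\in LV(B)}[E_L(U)]_{q_L}\cdot\prod_{U\in RV(B)}[E_R(U)]_{q_R}}.$$ -/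

import Mathlib

noncomputable section

namespace QHook

/-- The two directions of a binary tree. -/
inductive Side where
  | left
  | right
  deriving DecidableEq

/-- A (possible) vertex of a binary tree is encoded by the sequence of directions that lead to it
from the root; the root is the empty sequence. -/
abbrev Path : Type := List Side

/-- The set of vertices of a binary tree. -/
def vertices : BinaryTree Unit → Finset Path
  | .nil => ∅
  | .node _ l r =>
      insert [] ((vertices l).image (List.cons Side.left) ∪ (vertices r).image (List.cons Side.right))

/-- The vertex `v` is a child in direction `d` of its parent (the root is neither a left nor a right
child). -/
def IsChild (d : Side) (v : Path) : Prop := v.getLast? = some d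

instance (d : Side) : DecidablePred (IsChild d) := fun v =>
  inferInstanceAs (Decidable (v.getLast? = some d))

/-- `children .left B` is the set `LV(B)` of left children of `B`, and `children .right B` is the
set `RV(B)` of right children. -/
def children (d : Side) (B : BinaryTree Unit) : Finset Path := (vertices B).filter (IsChild d)

/-- `U` is a proper ancestor of `V`. -/
def IsProperAncestor (U V : Path) : Prop := U <+: V ∧ U ≠ V

/-- A non-ambiguous tree of shape `B`. The labels `1, …, n` of the left (resp. right) children
are encoded by the elements `0, …, n - 1` of `Fin n`, where `n` is their number. Every label is used
exactly once, and the label of a left (resp. right) child is strictly greater than those of the left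
(resp. right) children which are its proper descendants. -/
@[ext]
structure NAT (B : BinaryTree Unit) where
  label : (d : Side) → {v : Path // v ∈ children d B} ≃ Fin (children d B).card
  decreasing : ∀ (d : Side) (U V : {v : Path // v ∈ children d B}),
    IsProperAncestor U.1 V.1 → label d V < label d U

instance : Fintype Side := ⟨{Side.left, Side.right}, fun d => by cases d <;> simp⟩

instance (B : BinaryTree Unit) : Fintype (NAT B) :=
  Fintype.ofInjective NAT.label fun _ _ h => NAT.ext h

/-- The vertices of a binary tree in `d`-postfix order: first those of the subtree in direction `d`,
then those of the other subtree, and finally the root. -/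
def postfixOrder (d : Side) : BinaryTree Unit → List Path
  | .nil => []
  | .node _ l r =>
      match d with
      | .left => (postfixOrder d l).map (List.cons Side.left) ++
          (postfixOrder d r).map (List.cons Side.right) ++ [[]]
      | .right => (postfixOrder d r).map (List.cons Side.right) ++
          (postfixOrder d l).map (List.cons Side.left) ++ [[]]

/-- The children in direction `d`, in `d`-postfix order. -/
def reading (d : Side) (B : BinaryTree Unit) : List Path :=
  (postfixOrder d B).filter (fun v => decide (IsChild d v))

theorem mem_postfixOrder (d : Side) (B : BinaryTree Unit) (v : Path) :
    v ∈ postfixOrder d B ↔ v ∈ vertices B := by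
  induction B generalizing v with
  | nil => simp [postfixOrder, vertices]
  | node a l r hl hr => cases d <;> simp [postfixOrder, vertices, hl, hr] <;> grind

theorem nodup_postfixOrder (d : Side) (B : BinaryTree Unit) : (postfixOrder d B).Nodup := by
  induction B with
  | nil => simp [postfixOrder]
  | node a l r hl hr =>
    have h := fun s : Side => List.cons_injective (a := s)
    cases d <;>
      simp [postfixOrder, List.nodup_append, List.nodup_map_iff (h _), hl, hr] <;> aesop

theorem mem_reading (d : Side) (B : BinaryTree Unit) (v : Path) :
    v ∈ reading d B ↔ v ∈ children d B := by
  simp [reading, children, mem_postfixOrder]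

theorem nodup_reading (d : Side) (B : BinaryTree Unit) : (reading d B).Nodup :=
  (nodup_postfixOrder d B).filter _

theorem length_reading (d : Side) (B : BinaryTree Unit) :
    (reading d B).length = (children d B).card := by
  rw [← List.toFinset_card_of_nodup (nodup_reading d B)]
  congr 1
  ext v
  simp [mem_reading]

/-- The bijection that sends `i` to the `i`-th vertex in the reading of the children in
direction `d`. -/
def readingEquiv (d : Side) (B : BinaryTree Unit) :
    Fin (children d B).card ≃ {v : Path // v ∈ children d B} :=
  (finCongr (length_reading d B).symm).trans
    (((nodup_reading d B).getEquiv (reading d B)).trans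
      (Equiv.subtypeEquivRight (mem_reading d B)))

/-- The permutation `σ_L(T)` (for `d = .left`) or `σ_R(T)` (for `d = .right`): its one-line notation
is the sequence of the labels of the children in direction `d`, read in `d`-postfix order. -/
def NAT.perm {B : BinaryTree Unit} (T : NAT B) (d : Side) :
    Equiv.Perm (Fin (children d B).card) :=
  (readingEquiv d B).trans (T.label d)

/-- The number of inversions of a permutation. -/
def inv (n : ℕ) (σ : Equiv.Perm (Fin n)) : ℕ :=
  (Finset.univ.filter fun p : Fin n × Fin n => p.1 < p.2 ∧ σ p.2 < σ p.1).card

/-- The positions `i ∈ {1, …, n - 1}` with `σ(i) > σ(i + 1)` (positions and values being counted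
from `1`). -/
def descents {n : ℕ} (σ : Equiv.Perm (Fin n)) : Finset ℕ :=
  (Finset.range n).filter fun i =>
    ∃ j k : Fin n, (j : ℕ) + 1 = i ∧ (k : ℕ) + 1 = i + 1 ∧ σ k < σ j

/-- The inverse major index: the sum of the descents of the inverse permutation. -/
def imaj (n : ℕ) (σ : Equiv.Perm (Fin n)) : ℕ := ∑ i ∈ descents σ⁻¹, i

/-- The field `ℚ(q_L, q_R)` of rational functions in two indeterminates. -/
abbrev QField : Type := FractionRing (MvPolynomial Side ℚ)

/-- The indeterminates `q_L = q .left` and `q_R = q .right`. -/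
def q (d : Side) : QField := algebraMap (MvPolynomial Side ℚ) QField (MvPolynomial.X d)

/-- The `q`-integer `[n]_x`. -/
def qInt {K : Type*} [Field K] (x : K) (n : ℕ) : K := (1 - x ^ n) / (1 - x)

/-- The `q`-factorial `[n]_x!`. -/
def qFactorial {K : Type*} [Field K] (x : K) (n : ℕ) : K := ∏ i ∈ Finset.Icc 1 n, qInt x i

/-- The weight `q_L ^ S(σ_L(T)) * q_R ^ S(σ_R(T))` of a non-ambiguous tree. -/
def weight (S : (n : ℕ) → Equiv.Perm (Fin n) → ℕ) {B : BinaryTree Unit} (T : NAT B) : QField :=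
  q .left ^ S _ (T.perm .left) * q .right ^ S _ (T.perm .right)

/-- `E_L(U)` (for `d = .left`) or `E_R(U)` (for `d = .right`): the number of children in direction `d`
among the vertices of the subtree of `B` with root `U`, where `U` itself is included. -/
def hookCount (d : Side) (B : BinaryTree Unit) (U : Path) : ℕ :=
  ((children d B).filter fun V => U <+: V).card

end QHook

end

/-! The order conditions on left labels and on right labels are independent, so a NAT is a pair of
linear extensions, one for the forest of left children and one for that of right children. Each
forest is numbered by its own postfix reading, where every subtree is an interval ending at its
root. Since `inv` is invariant under inversion and `imaj` is `maj` of the inverse, the theorem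
becomes the q-hook length formula for postfix-ordered forests, for `inv` and `maj`.

That formula follows by induction on the last letter `r` of a linear extension, which must be a
root. The roots' intervals partition the positions, so the sum of `x ^ (n - r) * [h r]` over roots
is `[n + 1]` (`sum_roots_geom`). It therefore suffices that the extensions ending in `r` contribute
`x ^ (n - r) * [n]!` divided by the other hooks. For `inv` this is immediate, as `r` creates `n - r`
inversions. For `maj` it needs its own induction on the last two letters (`linExtSumLast_maj`). -/

namespace QHook

open Finset

/-! ### Permutations and their largest argument -/

/-- The permutation of `Fin (n + 1)` whose one-line notation ends with `r` and is obtained by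
appending `r` to that of `τ`, the letters of `τ` that are at least `r` being raised by one. -/
noncomputable def insertLast {n : ℕ} (r : Fin (n + 1)) (τ : Equiv.Perm (Fin n)) : Equiv.Perm (Fin (n + 1)) :=
  finSuccEquivLast.trans ((Equiv.optionCongr τ).trans (finSuccEquiv' r).symm)

@[simp] theorem insertLast_last {n : ℕ} (r : Fin (n + 1)) (τ : Equiv.Perm (Fin n)) :
    insertLast r τ (Fin.last n) = r := by
  simp [insertLast]

@[simp] theorem insertLast_castSucc {n : ℕ} (r : Fin (n + 1)) (τ : Equiv.Perm (Fin n))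
    (i : Fin n) : insertLast r τ i.castSucc = r.succAbove (τ i) := by
  simp [insertLast]

theorem bijective_insertLast (n : ℕ) :
    Function.Bijective fun p : Fin (n + 1) × Equiv.Perm (Fin n) => insertLast p.1 p.2 := by
  rw [Fintype.bijective_iff_injective_and_card]
  constructor
  · rintro ⟨r, τ⟩ ⟨r', τ'⟩ h
    have hr : r = r' := by simpa using congrArg (fun σ => σ (Fin.last n)) h
    subst hr
    refine Prod.ext rfl (Equiv.ext fun i => ?_)
    simpa using congrArg (fun σ => σ i.castSucc) h
  · simp [Fintype.card_perm, Nat.factorial_succ]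

theorem sum_perm_succ {n : ℕ} {M : Type*} [AddCommMonoid M] (f : Equiv.Perm (Fin (n + 1)) → M) :
    ∑ ω, f ω = ∑ r, ∑ τ, f (insertLast r τ) := by
  rw [← (bijective_insertLast n).sum_comp f, Fintype.sum_prod_type]

theorem inv_inverse (n : ℕ) (σ : Equiv.Perm (Fin n)) : inv n σ⁻¹ = inv n σ := by
  unfold inv
  -- The inversion `(a, b)` of `σ⁻¹` corresponds to the inversion `(σ⁻¹ b, σ⁻¹ a)` of `σ`.
  refine Finset.card_equiv ((Equiv.prodComm _ _).trans (Equiv.prodCongr σ⁻¹ σ⁻¹)) ?_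
  rintro ⟨a, b⟩
  simp [and_comm]

/-- The new inversions pair the last position with each of the `n - r` letters above `r`. -/
theorem inv_insertLast {n : ℕ} (r : Fin (n + 1)) (τ : Equiv.Perm (Fin n)) :
    inv (n + 1) (insertLast r τ) = inv n τ + (n - r) := by
  have key : ∀ (m : ℕ) (σ : Equiv.Perm (Fin m)),
      inv m σ = ∑ b : Fin m, ∑ a : Fin m, if a < b ∧ σ b < σ a then 1 else 0 := by
    intro m σ
    rw [inv, Finset.card_filter, Fintype.sum_prod_type, Finset.sum_comm]
  rw [key, key, Fin.sum_univ_castSucc]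
  congr 1
  · refine Finset.sum_congr rfl fun b _ => ?_
    rw [Fin.sum_univ_castSucc]
    simp [Fin.le_last]
  · rw [Fin.sum_univ_castSucc]
    simp only [insertLast_last, insertLast_castSucc, Fin.castSucc_lt_last, true_and, lt_irrefl,
      false_and, if_false, add_zero]
    rw [Equiv.sum_comp τ (fun i => if r < r.succAbove i then 1 else 0), ← Finset.card_filter]
    have : (univ.filter fun i : Fin n => r < r.succAbove i) =
        univ.filter fun i : Fin n => (r : ℕ) ≤ i := by
      ext i
      simp [Fin.lt_succAbove_iff_le_castSucc, Fin.le_def]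
    rw [this, ← Finset.card_map Fin.valEmbedding]
    have : (univ.filter fun i : Fin n => (r : ℕ) ≤ i).map Fin.valEmbedding = Finset.Ico (r : ℕ) n := by
      ext k
      simp only [mem_map, mem_filter, mem_univ, true_and, Fin.valEmbedding_apply, mem_Ico]
      constructor
      · rintro ⟨i, h, rfl⟩
        exact ⟨h, i.2⟩
      · rintro ⟨h, h'⟩
        exact ⟨⟨k, h'⟩, h, rfl⟩
    rw [this, Nat.card_Ico]

/-- The major index: the sum of the descents. -/
noncomputable def maj (n : ℕ) (σ : Equiv.Perm (Fin n)) : ℕ := ∑ i ∈ descents σ, i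

theorem mem_descents_succ {n : ℕ} (σ : Equiv.Perm (Fin (n + 1))) (i : ℕ) :
    i + 1 ∈ descents σ ↔
      ∃ h : i + 1 < n + 1, σ ⟨i + 1, h⟩ < σ ⟨i, by omega⟩ := by
  simp only [descents, mem_filter, mem_range]
  constructor
  · rintro ⟨h, j, k, hj, hk, hjk⟩
    have hj' : j = ⟨i, by omega⟩ := Fin.ext (by simpa using hj)
    have hk' : k = ⟨i + 1, h⟩ := Fin.ext (by simpa using hk)
    exact ⟨h, hj' ▸ hk' ▸ hjk⟩
  · rintro ⟨h, hlt⟩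
    exact ⟨h, _, _, rfl, rfl, hlt⟩

/-- Raising letters preserves comparisons, so the only possible new descent is at `n + 1`; a letter
exceeds `r` after raising exactly when it was at least `r` before. -/
theorem maj_insertLast {n : ℕ} (r : Fin (n + 2)) (τ : Equiv.Perm (Fin (n + 1))) :
    maj (n + 2) (insertLast r τ) =
      maj (n + 1) τ + if (r : ℕ) ≤ τ (Fin.last n) then n + 1 else 0 := by
  have hlast : n + 1 ∈ descents (insertLast r τ) ↔ (r : ℕ) ≤ τ (Fin.last n) := by
    rw [mem_descents_succ]
    have h1 : (⟨n + 1, by omega⟩ : Fin (n + 2)) = Fin.last (n + 1) := rfl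
    have h2 : (⟨n, by omega⟩ : Fin (n + 2)) = (Fin.last n).castSucc := rfl
    simp [h1, h2, Fin.lt_succAbove_iff_le_castSucc, Fin.le_def]
  have hlow : ∀ i, i ≠ n + 1 → (i ∈ descents (insertLast r τ) ↔ i ∈ descents τ) := by
    intro i hi
    rcases i with _ | i
    · simp [descents]
    rw [mem_descents_succ, mem_descents_succ]
    have H : ∀ (k : ℕ) (hk : k < n + 1), insertLast r τ ⟨k, by omega⟩ = r.succAbove (τ ⟨k, hk⟩) :=
      fun k hk => insertLast_castSucc r τ ⟨k, hk⟩
    constructor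
    · rintro ⟨h, hlt⟩
      have h' : i + 1 < n + 1 := by omega
      rw [H _ h', H _ (by omega), Fin.succAbove_lt_succAbove_iff] at hlt
      exact ⟨h', hlt⟩
    · rintro ⟨h', hlt⟩
      refine ⟨by omega, ?_⟩
      rw [H _ h', H _ (by omega), Fin.succAbove_lt_succAbove_iff]
      exact hlt
  have hnot : n + 1 ∉ descents τ := by simp [descents]
  unfold maj
  split_ifs with h
  · have : descents (insertLast r τ) = insert (n + 1) (descents τ) := by
      ext i
      by_cases hi : i = n + 1
      · simp [hi, hlast, h]
      · simp [hi, hlow i hi]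
    rw [this, Finset.sum_insert hnot, add_comm]
  · have : descents (insertLast r τ) = descents τ := by
      ext i
      by_cases hi : i = n + 1
      · simp [hi, hlast, h, hnot]
      · simp [hlow i hi]
    rw [this, add_zero]

/-! ### Forests in postfix order -/

/-- In the forest with vertices `Fin n` in postfix order and hook lengths `h`, the subtree of `i`
is the interval of length `h i` that ends at `i`. -/
structure IsForest {n : ℕ} (h : Fin n → ℕ) : Prop where
  pos : ∀ i, 1 ≤ h i
  le : ∀ i, h i ≤ i + 1
  laminar : ∀ j i : Fin n, j ≤ i → (i : ℕ) < j + h i → h j + i ≤ j + h i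

/-- `j` is a proper descendant of `i`. -/
noncomputable def IsDesc {n : ℕ} (h : Fin n → ℕ) (j i : Fin n) : Prop := j < i ∧ (i : ℕ) < j + h i

/-- `r` is a root of the forest. -/
noncomputable def IsRoot {n : ℕ} (h : Fin n → ℕ) (r : Fin n) : Prop := ∀ i, ¬ IsDesc h r i

/-- `ω` lists the vertices of the forest in such a way that descendants precede their ancestors. -/
noncomputable def IsLinExt {n : ℕ} (h : Fin n → ℕ) (ω : Equiv.Perm (Fin n)) : Prop :=
  ∀ a b, IsDesc h (ω a) (ω b) → a < b

theorem val_succAbove {n : ℕ} (r : Fin (n + 1)) (i : Fin n) :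
    ((r.succAbove i : Fin (n + 1)) : ℕ) = if (i : ℕ) < r then (i : ℕ) else i + 1 := by
  simp only [Fin.succAbove, Fin.lt_def, Fin.val_castSucc]
  split_ifs <;> simp

/-- A root lies in no other vertex's interval, so deleting it shifts the remaining intervals without
changing their lengths. -/
theorem IsRoot.isDesc_succAbove {n : ℕ} {h : Fin (n + 1) → ℕ} {r : Fin (n + 1)}
    (hr : IsRoot h r) (j i : Fin n) :
    IsDesc (h ∘ r.succAbove) j i ↔ IsDesc h (r.succAbove j) (r.succAbove i) := by
  have hri := hr (r.succAbove i)
  simp only [IsDesc, Function.comp, Fin.lt_def, val_succAbove] at hri ⊢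
  split_ifs at hri ⊢ <;> omega

theorem IsForest.succAbove {n : ℕ} {h : Fin (n + 1) → ℕ} (hf : IsForest h) {r : Fin (n + 1)}
    (hr : IsRoot h r) : IsForest (h ∘ r.succAbove) where
  pos i := hf.pos _
  le i := by
    have h1 := hf.le (r.succAbove i)
    have hri := hr (r.succAbove i)
    simp only [IsDesc, Function.comp, Fin.lt_def, val_succAbove] at hri h1 ⊢
    split_ifs at hri h1 ⊢ <;> omega
  laminar j i hji hlt := by
    have h1 := hf.laminar (r.succAbove j) (r.succAbove i)
    have hri := hr (r.succAbove i)
    simp only [IsDesc, Function.comp, Fin.lt_def, Fin.le_def, val_succAbove] at *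
    split_ifs at hri h1 ⊢ <;> omega

theorem isLinExt_insertLast {n : ℕ} (h : Fin (n + 1) → ℕ) (r : Fin (n + 1))
    (τ : Equiv.Perm (Fin n)) :
    IsLinExt h (insertLast r τ) ↔ IsRoot h r ∧ IsLinExt (h ∘ r.succAbove) τ := by
  constructor
  · intro H
    have hr : IsRoot h r := by
      intro i hi
      obtain ⟨j, rfl⟩ := Fin.exists_succAbove_eq hi.1.ne'
      have := H (Fin.last n) (τ.symm j).castSucc (by simpa using hi)
      exact absurd this (not_lt.2 (Fin.le_last _))
    refine ⟨hr, fun a b hab => ?_⟩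
    have := H a.castSucc b.castSucc (by simpa using (hr.isDesc_succAbove _ _).1 hab)
    simpa using this
  · rintro ⟨hr, H⟩ a b
    refine Fin.lastCases ?_ (fun a => ?_) a
    · intro hd
      rw [insertLast_last] at hd
      exact absurd hd (hr _)
    · refine Fin.lastCases ?_ (fun b => ?_) b
      · exact fun _ => Fin.castSucc_lt_last a
      · intro hd
        rw [insertLast_castSucc, insertLast_castSucc, ← hr.isDesc_succAbove] at hd
        exact Fin.castSucc_lt_castSucc_iff.2 (H a b hd)

/-- Among the intervals containing `k`, the one with the largest endpoint belongs to a root: by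
laminarity an ancestor's interval would contain `k` too. -/
theorem IsForest.exists_root {n : ℕ} {h : Fin n → ℕ} (hf : IsForest h) {k : ℕ} (hk : k < n) :
    ∃ r, IsRoot h r ∧ k ≤ r ∧ (r : ℕ) < k + h r := by
  set A := (univ.filter fun i : Fin n => k ≤ i ∧ (i : ℕ) < k + h i) with hA
  have hne : A.Nonempty := by
    refine ⟨⟨k, hk⟩, ?_⟩
    have := hf.pos ⟨k, hk⟩
    simp only [hA, mem_filter, mem_univ, true_and]
    omega
  obtain ⟨m, hm, hmax⟩ : ∃ m ∈ A, ∀ i ∈ A, i ≤ m := ⟨A.max' hne, A.max'_mem hne, A.le_max'⟩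
  simp only [hA, mem_filter, mem_univ, true_and] at hm hmax
  refine ⟨m, fun i hi => ?_, hm⟩
  have h1 := hf.laminar m i hi.1.le hi.2
  have h2 := hmax i ⟨by have := Fin.lt_def.1 hi.1; omega, by omega⟩
  exact absurd hi.1 (not_lt.2 h2)

theorem IsRoot.eq_of_mem {n : ℕ} {h : Fin n → ℕ} {r s : Fin n} (hr : IsRoot h r)
    (hs : IsRoot h s) {k : ℕ} (hkr : k ≤ r) (hrk : (r : ℕ) < k + h r) (hks : k ≤ s)
    (hsk : (s : ℕ) < k + h s) : r = s := by
  rcases lt_trichotomy r s with hlt | heq | hlt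
  · exact absurd ⟨hlt, by omega⟩ (hr s)
  · exact heq
  · exact absurd ⟨hlt, by omega⟩ (hs r)

open Classical in
/-- The subtrees of the roots partition the forest. -/
theorem IsForest.sum_roots {n : ℕ} {h : Fin n → ℕ} (hf : IsForest h) {M : Type*}
    [AddCommMonoid M] (f : ℕ → M) :
    ∑ r with IsRoot h r, ∑ k ∈ range (h r), f (r - k) = ∑ k ∈ range n, f k := by
  rw [Finset.sum_sigma']
  refine Finset.sum_bij (fun p _ => (p.1 : ℕ) - p.2) ?_ ?_ ?_ fun _ _ => rfl
  · rintro ⟨r, k⟩ -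
    simp only [mem_range]
    omega
  · rintro ⟨r, k⟩ hp ⟨s, l⟩ hp' heq
    simp only [mem_sigma, mem_filter, mem_univ, true_and, mem_range] at hp hp' heq
    have h1 := hf.le r
    have h2 := hf.le s
    obtain rfl : r = s :=
      hp.1.eq_of_mem hp'.1 (k := r - k) (by omega) (by omega) (by omega) (by omega)
    obtain rfl : k = l := by omega
    rfl
  · intro k hk
    obtain ⟨r, hr, h1, h2⟩ := hf.exists_root (mem_range.1 hk)
    refine ⟨⟨r, r - k⟩, ?_, by simp only; omega⟩
    simp only [mem_sigma, mem_filter, mem_univ, true_and, mem_range]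
    exact ⟨hr, by omega⟩

/-! ### The hook length formula for forests -/

section Hook

variable {R : Type*} [CommSemiring R] (x : R)

/-- The `q`-integer as a geometric sum. -/
noncomputable def geom (n : ℕ) : R := ∑ i ∈ range n, x ^ i

/-- The `q`-factorial as a product of geometric sums. -/
noncomputable def geomFactorial (n : ℕ) : R := ∏ i ∈ range n, geom x (i + 1)

open Classical in
/-- The enumerator of the linear extensions of a forest by a statistic. -/
noncomputable def linExtSum (S : (n : ℕ) → Equiv.Perm (Fin n) → ℕ) {n : ℕ} (h : Fin n → ℕ) : R :=
  ∑ ω with IsLinExt h ω, x ^ S n ω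

open Classical in
/-- The enumerator of the linear extensions of a forest that end with `r`. -/
noncomputable def linExtSumLast (S : (n : ℕ) → Equiv.Perm (Fin n) → ℕ) {n : ℕ} (h : Fin (n + 1) → ℕ)
    (r : Fin (n + 1)) : R :=
  ∑ τ with IsLinExt (h ∘ r.succAbove) τ, x ^ S (n + 1) (insertLast r τ)

open Classical in
theorem sum_linExt_succ {n : ℕ} (h : Fin (n + 1) → ℕ) (f : Equiv.Perm (Fin (n + 1)) → R) :
    ∑ ω with IsLinExt h ω, f ω =
      ∑ r with IsRoot h r, ∑ τ with IsLinExt (h ∘ r.succAbove) τ, f (insertLast r τ) := by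
  rw [Finset.sum_filter, sum_perm_succ, Finset.sum_filter]
  refine Finset.sum_congr rfl fun r _ => ?_
  rw [Finset.sum_filter]
  by_cases hr : IsRoot h r <;> simp [isLinExt_insertLast, hr]

theorem sum_pow_interval (x : R) {a m c : ℕ} (hm : m ≤ a + 1) (hc : a ≤ c) :
    ∑ k ∈ range m, x ^ (c - (a - k)) = x ^ (c - a) * geom x m := by
  rw [geom, Finset.mul_sum]
  refine Finset.sum_congr rfl fun k hk => ?_
  rw [← pow_add]
  congr 1
  have := mem_range.1 hk
  omega

theorem sum_range_pow_sub (x : R) (n : ℕ) : ∑ k ∈ range (n + 1), x ^ (n - k) = geom x (n + 1) := by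
  exact Finset.sum_range_reflect (fun i => x ^ i) (n + 1)

-- Give position `k` the weight `x ^ (n - k)`: the interval of a root `r` then weighs `x ^ (n - r) *
-- [h r]`.
open Classical in
theorem IsForest.sum_roots_geom {n : ℕ} {h : Fin (n + 1) → ℕ} (hf : IsForest h) :
    ∑ r with IsRoot h r, x ^ (n - r : ℕ) * geom x (h r) = geom x (n + 1) := by
  rw [← sum_range_pow_sub, ← hf.sum_roots]
  refine Finset.sum_congr rfl fun r _ => ?_
  rw [sum_pow_interval x (hf.le r) (by omega)]

open Classical in
theorem IsForest.linExtSum_mul_prod {S : (n : ℕ) → Equiv.Perm (Fin n) → ℕ} {n : ℕ}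
    {h : Fin (n + 1) → ℕ} (hf : IsForest h)
    (H : ∀ r, IsRoot h r → linExtSumLast x S h r * ∏ i, geom x (h (r.succAbove i)) =
      x ^ (n - r : ℕ) * geomFactorial x n) :
    linExtSum x S h * ∏ i, geom x (h i) = geomFactorial x (n + 1) := by
  rw [linExtSum, sum_linExt_succ, Finset.sum_mul, geomFactorial, prod_range_succ,
    ← geomFactorial, ← hf.sum_roots_geom, Finset.mul_sum]
  refine Finset.sum_congr rfl fun r hr => ?_
  rw [Fin.prod_univ_succAbove _ r]
  calc _ = (linExtSumLast x S h r * ∏ i, geom x (h (r.succAbove i))) * geom x (h r) := by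
        rw [linExtSumLast]; ring
    _ = _ := by
        rw [H r (by simpa using hr)]; ring

theorem linExtSum_zero {S : (n : ℕ) → Equiv.Perm (Fin n) → ℕ} (hS : ∀ τ, S 0 τ = 0)
    (h : Fin 0 → ℕ) : linExtSum x S h = 1 := by
  classical
  have : ∀ τ, IsLinExt h τ := fun τ a => a.elim0
  simp [linExtSum, hS, this]

theorem IsForest.linExtSum_inv {n : ℕ} {h : Fin n → ℕ} (hf : IsForest h) :
    linExtSum x inv h * ∏ i, geom x (h i) = geomFactorial x n := by
  induction n with
  | zero => simp [geomFactorial, linExtSum_zero, inv]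
  | succ n ih =>
    refine hf.linExtSum_mul_prod x fun r hr => ?_
    rw [← ih (hf.succAbove hr), linExtSumLast, linExtSum]
    simp only [inv_insertLast, pow_add, ← Finset.sum_mul, Function.comp]
    ring

-- The analogue of `sum_roots_geom` for the letter `u` just before `r`, with a factor `x ^ (n + 1)`
-- when the pair forms a descent.
open Classical in
theorem IsForest.sum_roots_geom_succAbove {n : ℕ} {h : Fin (n + 2) → ℕ} (hf : IsForest h)
    {r : Fin (n + 2)} (hr : IsRoot h r) :
    ∑ u with IsRoot (h ∘ r.succAbove) u,
      x ^ (if (r : ℕ) ≤ u then n + 1 else 0) * (x ^ (n - u : ℕ) * geom x (h (r.succAbove u))) =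
      x ^ (n + 1 - r : ℕ) * geom x (n + 1) := by
  have hf' := hf.succAbove hr
  have h1 : ∑ u with IsRoot (h ∘ r.succAbove) u,
      x ^ (if (r : ℕ) ≤ u then n + 1 else 0) * (x ^ (n - u : ℕ) * geom x (h (r.succAbove u))) =
      ∑ k ∈ range (n + 1), x ^ (if (r : ℕ) ≤ k then n + 1 else 0) * x ^ (n - k) := by
    rw [← hf'.sum_roots]
    refine Finset.sum_congr rfl fun u _ => ?_
    have hle := hf'.le u
    rw [Function.comp] at hle ⊢
    rw [← sum_pow_interval x hle (by omega), Finset.mul_sum]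
    refine Finset.sum_congr rfl fun k hk => ?_
    have hk := mem_range.1 hk
    -- As `r` is not below `u`, the interval of `u` lies on one side of the gap left by `r`, so the
    -- descent condition is the same at all its positions.
    have hru := hr (r.succAbove u)
    congr 2
    simp only [IsDesc, Fin.lt_def, val_succAbove] at hru
    split_ifs at hru ⊢ <;> omega
  rw [h1, geom, Finset.mul_sum]
  -- Positions `k < r` give the exponents `n + 1 - r, …, n` and positions `k ≥ r` give `n + 1, …, 2n
  -- + 1 - r`: together `n + 1` consecutive values, each half in reverse order.
  refine Finset.sum_bij' (fun k _ => if (r : ℕ) ≤ k then n + r - k else r - 1 - k)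
    (fun k _ => if k < r then r - 1 - k else n + r - k) ?_ ?_ ?_ ?_ ?_
  · intro k hk
    rw [mem_range] at hk ⊢
    split_ifs <;> omega
  · intro k hk
    rw [mem_range] at hk ⊢
    split_ifs <;> omega
  · intro k hk
    rw [mem_range] at hk
    split_ifs <;> omega
  · intro k hk
    rw [mem_range] at hk
    split_ifs <;> omega
  · intro k hk
    rw [mem_range] at hk
    rw [← pow_add, ← pow_add]
    congr 1
    split_ifs <;> omega

-- The effect of `r` on `maj` depends on the preceding letter, so the induction must keep track of
-- the last letter.
open Classical in
theorem IsForest.linExtSumLast_maj {n : ℕ} {h : Fin (n + 1) → ℕ} (hf : IsForest h)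
    {r : Fin (n + 1)} (hr : IsRoot h r) :
    linExtSumLast x maj h r * ∏ i, geom x (h (r.succAbove i)) =
      x ^ (n - r : ℕ) * geomFactorial x n := by
  induction n with
  | zero =>
    have : ∀ τ, IsLinExt (h ∘ r.succAbove) τ := fun τ a => a.elim0
    have h2 : ∀ σ, maj 1 σ = 0 := by
      intro σ
      refine Finset.sum_eq_zero fun i hi => ?_
      have := mem_range.1 (mem_filter.1 hi).1
      omega
    simp [linExtSumLast, this, geomFactorial, h2]
  | succ n ih =>
    have hf' := hf.succAbove hr
    rw [linExtSumLast, sum_linExt_succ, Finset.sum_mul, geomFactorial, prod_range_succ,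
      ← geomFactorial, mul_left_comm, ← hf.sum_roots_geom_succAbove x hr, Finset.mul_sum]
    refine Finset.sum_congr rfl fun u hu => ?_
    have hu : IsRoot (h ∘ r.succAbove) u := by simpa using hu
    have := ih hf' hu
    simp only [maj_insertLast, insertLast_last, pow_add, ← Finset.sum_mul]
    rw [Fin.prod_univ_succAbove _ u]
    calc _ = (linExtSumLast x maj (h ∘ r.succAbove) u *
            ∏ i, geom x ((h ∘ r.succAbove) (u.succAbove i))) *
          (x ^ (if (r : ℕ) ≤ u then n + 1 else 0) * geom x (h (r.succAbove u))) := by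
          simp only [linExtSumLast, Function.comp_apply]
          ring
      _ = _ := by
          rw [this]
          ring

theorem IsForest.linExtSum_maj {n : ℕ} {h : Fin n → ℕ} (hf : IsForest h) :
    linExtSum x maj h * ∏ i, geom x (h i) = geomFactorial x n := by
  cases n with
  | zero => simp [geomFactorial, linExtSum_zero, maj, descents]
  | succ n => exact hf.linExtSum_mul_prod x fun r hr => hf.linExtSumLast_maj x hr

end Hook

/-! ### The reading of a binary tree -/

/-- The descendants of each path of the list form an interval that ends at this path. -/
def IsPostfixList (L : List Path) : Prop :=
  ∀ v ∈ L, ∃ A D C : List Path, L = A ++ (D ++ v :: C) ∧ (∀ w ∈ A, ¬ v <+: w) ∧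
    (∀ w ∈ D, v <+: w) ∧ ∀ w ∈ C, ¬ v <+: w

theorem IsPostfixList.map_cons {L : List Path} (hL : IsPostfixList L) (s : Side) :
    IsPostfixList (L.map (List.cons s)) := by
  intro v hv
  obtain ⟨v, hv', rfl⟩ := List.mem_map.1 hv
  obtain ⟨A, D, C, rfl, hA, hD, hC⟩ := hL v hv'
  refine ⟨A.map (List.cons s), D.map (List.cons s), C.map (List.cons s), by simp, ?_, ?_, ?_⟩ <;>
    simpa [List.cons_prefix_cons]

theorem IsPostfixList.append {L M : List Path} (hL : IsPostfixList L) (hM : IsPostfixList M)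
    (hLM : ∀ v ∈ L, ∀ w ∈ M, ¬ v <+: w) (hML : ∀ v ∈ M, ∀ w ∈ L, ¬ v <+: w) :
    IsPostfixList (L ++ M) := by
  intro v hv
  rcases List.mem_append.1 hv with h | h
  · obtain ⟨A, D, C, heq, hA, hD, hC⟩ := hL v h
    refine ⟨A, D, C ++ M, by simp [heq], hA, hD, fun w hw => ?_⟩
    rcases List.mem_append.1 hw with hw | hw
    exacts [hC w hw, hLM v h w hw]
  · obtain ⟨A, D, C, heq, hA, hD, hC⟩ := hM v h
    refine ⟨L ++ A, D, C, by simp [heq], fun w hw => ?_, hD, hC⟩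
    rcases List.mem_append.1 hw with hw | hw
    exacts [hML v h w hw, hA w hw]

theorem IsPostfixList.append_root {L : List Path} (hL : IsPostfixList L) (hne : [] ∉ L) :
    IsPostfixList (L ++ [[]]) := by
  intro v hv
  rcases List.mem_append.1 hv with h | h
  · obtain ⟨A, D, C, heq, hA, hD, hC⟩ := hL v h
    refine ⟨A, D, C ++ [[]], by simp [heq], hA, hD, fun w hw => ?_⟩
    rcases List.mem_append.1 hw with hw | hw
    · exact hC w hw
    · obtain rfl := List.mem_singleton.1 hw
      rw [List.prefix_nil]
      rintro rfl
      exact hne h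
  · obtain rfl := List.mem_singleton.1 h
    exact ⟨[], L, [], by simp, by simp, by simp, by simp⟩

/-- Filtering acts on each block separately; this passes the interval property from all vertices to
the children in one direction. -/
theorem IsPostfixList.filter {L : List Path} (hL : IsPostfixList L) (p : Path → Bool) :
    IsPostfixList (L.filter p) := by
  intro v hv
  obtain ⟨hv, hp⟩ := List.mem_filter.1 hv
  obtain ⟨A, D, C, rfl, hA, hD, hC⟩ := hL v hv
  refine ⟨A.filter p, D.filter p, C.filter p, by simp [hp], ?_, ?_, ?_⟩
  · exact fun w hw => hA w (List.mem_filter.1 hw).1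
  · exact fun w hw => hD w (List.mem_filter.1 hw).1
  · exact fun w hw => hC w (List.mem_filter.1 hw).1

theorem isPostfixList_postfixOrder (d : Side) (B : BinaryTree Unit) :
    IsPostfixList (postfixOrder d B) := by
  induction B with
  | nil => intro v hv; simp [postfixOrder] at hv
  | node a l r hl hr =>
    cases d
    · exact ((hl.map_cons _).append (hr.map_cons _) (by simp [List.cons_prefix_cons])
        (by simp [List.cons_prefix_cons])).append_root (by simp)
    · exact ((hr.map_cons _).append (hl.map_cons _) (by simp [List.cons_prefix_cons])
        (by simp [List.cons_prefix_cons])).append_root (by simp)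

theorem isPostfixList_reading (d : Side) (B : BinaryTree Unit) : IsPostfixList (reading d B) :=
  (isPostfixList_postfixOrder d B).filter _

theorem readingEquiv_val (d : Side) (B : BinaryTree Unit) (i : Fin (children d B).card) :
    (readingEquiv d B i).1 = (reading d B)[(i : ℕ)]'(by rw [length_reading]; exact i.2) := rfl

theorem hookCount_eq_length (d : Side) (B : BinaryTree Unit) (v : Path) :
    hookCount d B v = ((reading d B).filter fun w => decide (v <+: w)).length := by
  rw [hookCount, ← List.toFinset_card_of_nodup ((nodup_reading d B).filter _)]
  congr 1
  ext w
  simp [mem_reading]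

/-- The hook lengths of the children in direction `d`, in the order of the reading. -/
def hook (d : Side) (B : BinaryTree Unit) (i : Fin (children d B).card) : ℕ :=
  hookCount d B (readingEquiv d B i).1

theorem exists_interval (d : Side) (B : BinaryTree Unit) (i : Fin (children d B).card) :
    ∃ a : ℕ, a ≤ i ∧ hook d B i = i - a + 1 ∧
      ∀ j, (readingEquiv d B i).1 <+: (readingEquiv d B j).1 ↔ a ≤ j ∧ j ≤ i := by
  have hv := (mem_reading d B _).2 (readingEquiv d B i).2
  obtain ⟨A, D, C, heq, hA, hD, hC⟩ := isPostfixList_reading d B _ hv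
  have hi : A.length + D.length = i := by
    have h1 := readingEquiv_val d B i
    have hlen : A.length + D.length < (reading d B).length := by rw [heq]; simp
    have h2 : (reading d B)[A.length + D.length] = (readingEquiv d B i).1 := by
      simp [heq]
    exact (nodup_reading d B).getElem_inj_iff.1 (h2.trans h1)
  refine ⟨A.length, by omega, ?_, fun j => ?_⟩
  · rw [hook, hookCount_eq_length, heq, List.filter_append, List.filter_append,
      List.filter_cons_of_pos (by simp), List.filter_eq_nil_iff.2 (by simpa using hA),
      List.filter_eq_self.2 (by simpa using hD), List.filter_eq_nil_iff.2 (by simpa using hC)]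
    simp
    omega
  · have hj : (j : ℕ) < (reading d B).length := by rw [length_reading]; exact j.2
    rw [readingEquiv_val d B j, List.getElem_of_eq heq hj]
    rcases lt_or_ge (j : ℕ) A.length with h1 | h1
    · rw [List.getElem_append_left h1]
      exact iff_of_false (hA _ (List.getElem_mem _)) (by omega)
    rw [List.getElem_append_right h1]
    rcases lt_trichotomy ((j : ℕ) - A.length) D.length with h2 | h2 | h2
    · rw [List.getElem_append_left h2]
      exact iff_of_true (hD _ (List.getElem_mem _)) ⟨h1, by rw [Fin.le_def]; omega⟩
    · exact iff_of_true (by simp [h2]) ⟨h1, by rw [Fin.le_def]; omega⟩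
    · rw [List.getElem_append_right h2.le, List.getElem_cons, dif_neg (by omega)]
      exact iff_of_false (hC _ (List.getElem_mem _)) (by rw [Fin.le_def]; omega)

theorem prefix_iff (d : Side) (B : BinaryTree Unit) (i j : Fin (children d B).card) :
    (readingEquiv d B i).1 <+: (readingEquiv d B j).1 ↔
      j ≤ i ∧ (i : ℕ) < j + hook d B i := by
  obtain ⟨a, ha, hh, H⟩ := exists_interval d B i
  rw [H, hh, Fin.le_def]
  omega

theorem isForest_hook (d : Side) (B : BinaryTree Unit) : IsForest (hook d B) where
  pos i := by
    obtain ⟨a, ha, hh, -⟩ := exists_interval d B i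
    omega
  le i := by
    obtain ⟨a, ha, hh, -⟩ := exists_interval d B i
    omega
  laminar j i hji hlt := by
    obtain ⟨a, ha, hh, -⟩ := exists_interval d B j
    have h1 := (prefix_iff d B i j).2 ⟨hji, hlt⟩
    -- The vertex at `a` is the first in the subtree of `j`; by transitivity it also lies in that of
    -- `i`.
    have h2 : (readingEquiv d B j).1 <+: (readingEquiv d B ⟨a, by omega⟩).1 :=
      (prefix_iff d B j _).2 ⟨ha, by simp only; omega⟩
    have h3 := ((prefix_iff d B i _).1 (h1.trans h2)).2
    simp only at h3
    omega

theorem isDesc_hook_iff (d : Side) (B : BinaryTree Unit) (i j : Fin (children d B).card) :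
    IsDesc (hook d B) j i ↔ IsProperAncestor (readingEquiv d B i).1 (readingEquiv d B j).1 := by
  rw [IsProperAncestor, prefix_iff, IsDesc, Ne, ← Subtype.ext_iff,
    (readingEquiv d B).apply_eq_iff_eq, lt_iff_le_and_ne]
  tauto

/-! ### Non-ambiguous trees as pairs of linear extensions -/

/-- The inverse of `T.perm d` lists the vertices by increasing label, and labels increase from
descendants to ancestors. -/
theorem NAT.isLinExt {B : BinaryTree Unit} (T : NAT B) (d : Side) :
    IsLinExt (hook d B) (T.perm d)⁻¹ := by
  intro a b hab
  have := T.decreasing d _ _ ((isDesc_hook_iff d B _ _).1 hab)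
  have key : ∀ c, T.label d (readingEquiv d B ((T.perm d)⁻¹ c)) = c :=
    fun c => (T.perm d).apply_symm_apply c
  rwa [key, key] at this

/-- The non-ambiguous tree given by the linear extensions of its two forests. -/
def NAT.ofLinExt {B : BinaryTree Unit} (ω : (d : Side) → Equiv.Perm (Fin (children d B).card))
    (hω : ∀ d, IsLinExt (hook d B) (ω d)) : NAT B where
  label d := (readingEquiv d B).symm.trans (ω d)⁻¹
  decreasing d U V hUV := by
    apply hω d
    rw [isDesc_hook_iff]
    simpa using hUV

theorem NAT.perm_ofLinExt {B : BinaryTree Unit}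
    (ω : (d : Side) → Equiv.Perm (Fin (children d B).card))
    (hω : ∀ d, IsLinExt (hook d B) (ω d)) (d : Side) : (ofLinExt ω hω).perm d = (ω d)⁻¹ := by
  ext i
  simp [NAT.perm, ofLinExt]

theorem NAT.ext_perm {B : BinaryTree Unit} {T T' : NAT B} (h : ∀ d, T.perm d = T'.perm d) :
    T = T' := by
  refine NAT.ext (funext fun d => Equiv.ext fun v => ?_)
  simpa [NAT.perm] using congrArg (fun σ => σ ((readingEquiv d B).symm v)) (h d)

theorem sum_weight (B : BinaryTree Unit) {S S' : (n : ℕ) → Equiv.Perm (Fin n) → ℕ}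
    (hS : ∀ n σ, S n σ = S' n σ⁻¹) :
    ∑ T : NAT B, weight S T =
      linExtSum (q .left) S' (hook .left B) * linExtSum (q .right) S' (hook .right B) := by
  classical
  rw [linExtSum, linExtSum, Finset.sum_mul_sum, ← Finset.sum_product']
  refine Finset.sum_bij (fun T _ => ((T.perm .left)⁻¹, (T.perm .right)⁻¹)) ?_ ?_ ?_ ?_
  · intro T _
    simp [T.isLinExt]
  · intro T _ T' _ h
    refine NAT.ext_perm fun d => ?_
    simp only [Prod.mk.injEq, inv_inj] at h
    cases d
    exacts [h.1, h.2]
  · rintro ⟨ω₁, ω₂⟩ hω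
    simp only [mem_product, mem_filter, mem_univ, true_and] at hω
    refine ⟨NAT.ofLinExt (fun d => match d with | .left => ω₁ | .right => ω₂) ?_, mem_univ _, ?_⟩
    · intro d
      cases d
      exacts [hω.1, hω.2]
    · simp [NAT.perm_ofLinExt]
  · intro T _
    rw [weight, hS, hS]

/-! ### Passage to rational functions -/

theorem q_pow_ne_one (d : Side) {n : ℕ} (hn : n ≠ 0) : q d ^ n ≠ 1 := by
  intro h
  rw [q, ← map_pow, ← map_one (algebraMap (MvPolynomial Side ℚ) QField)] at h
  -- Evaluation at the origin turns `X d ^ n = 1` into `0 = 1`.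
  have := congrArg (MvPolynomial.eval 0) (IsFractionRing.injective _ _ h)
  simp [hn] at this

theorem qInt_eq_geom (d : Side) (n : ℕ) : qInt (q d) n = geom (q d) n := by
  have h1 : q d ≠ 1 := by simpa using q_pow_ne_one d one_ne_zero
  rw [qInt, geom, geom_sum_eq h1, ← neg_sub, ← neg_sub (q d), neg_div_neg_eq]

theorem qInt_ne_zero (d : Side) {n : ℕ} (hn : n ≠ 0) : qInt (q d) n ≠ 0 := by
  have h1 : q d ≠ 1 := by simpa using q_pow_ne_one d one_ne_zero
  exact div_ne_zero (sub_ne_zero.2 (q_pow_ne_one d hn).symm) (sub_ne_zero.2 h1.symm)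

theorem qFactorial_eq_geomFactorial (d : Side) (n : ℕ) :
    qFactorial (q d) n = geomFactorial (q d) n := by
  rw [qFactorial, geomFactorial]
  simp only [qInt_eq_geom]
  rw [Finset.range_eq_Ico, Finset.prod_Ico_add' (fun i => geom (q d) i) 0 n 1]
  rfl

theorem prod_qInt_hookCount (d : Side) (B : BinaryTree Unit) :
    ∏ U ∈ children d B, qInt (q d) (hookCount d B U) = ∏ i, qInt (q d) (hook d B i) := by
  rw [← Finset.prod_coe_sort, ← (readingEquiv d B).prod_comp]
  rfl

theorem linExtSum_hook {S : (n : ℕ) → Equiv.Perm (Fin n) → ℕ} (d : Side) (B : BinaryTree Unit)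
    (H : linExtSum (q d) S (hook d B) * ∏ i, geom (q d) (hook d B i) =
      geomFactorial (q d) (children d B).card) :
    linExtSum (q d) S (hook d B) = qFactorial (q d) (children d B).card /
      ∏ U ∈ children d B, qInt (q d) (hookCount d B U) := by
  rw [prod_qInt_hookCount, qFactorial_eq_geomFactorial, eq_div_iff, ← H]
  · simp only [qInt_eq_geom]
  · exact Finset.prod_ne_zero_iff.2 fun i _ =>
      qInt_ne_zero d (Nat.one_le_iff_ne_zero.1 ((isForest_hook d B).pos i))

end QHook

theorem mainTheorem4 (B : BinaryTree Unit) (hB : B ≠ BinaryTree.nil)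
    (S : (n : ℕ) → Equiv.Perm (Fin n) → ℕ) (hS : S = QHook.inv ∨ S = QHook.imaj) :
    ∑ T : QHook.NAT B, QHook.weight S T =
      (QHook.qFactorial (QHook.q .left) (QHook.children .left B).card *
          QHook.qFactorial (QHook.q .right) (QHook.children .right B).card) /
        ((∏ U ∈ QHook.children .left B,
            QHook.qInt (QHook.q .left) (QHook.hookCount .left B U)) *
          ∏ U ∈ QHook.children .right B,
            QHook.qInt (QHook.q .right) (QHook.hookCount .right B U)) := by
  rw [← div_mul_div_comm]
  rcases hS with rfl | rfl
  · rw [QHook.sum_weight B (S' := QHook.inv) fun n σ => (QHook.inv_inverse n σ).symm,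
      QHook.linExtSum_hook .left B ((QHook.isForest_hook .left B).linExtSum_inv _),
      QHook.linExtSum_hook .right B ((QHook.isForest_hook .right B).linExtSum_inv _)]
  · rw [QHook.sum_weight B (S := QHook.imaj) (S' := QHook.maj) fun _ _ => rfl,
      QHook.linExtSum_hook .left B ((QHook.isForest_hook .left B).linExtSum_maj _),
      QHook.linExtSum_hook .right B ((QHook.isForest_hook .right B).linExtSum_maj _)]
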